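/- Let $K$ be a number field with ring of integers $\mathcal{O}_K$ and algebraic closure $\overline{K}$. Let $d>m\geq 2$ be integers, let $b,x_0\in K$ with $x_0\neq 0$, and suppose there is a (nonzero) prime $\mathfrak{p}$ of $\mathcal{O}_K$, with normalized additive valuation $v_{\mathfrak{p}}$, such that $\mathfrak{p}\nmid (d-m)$ and $v_{\mathfrak{p}}(b)<\min\{v_{\mathfrak{p}}(x_0),0\}$, with $(d-m)\mid v_{\mathfrak{p}}(b)$ and $\gcd(m,v_{\mathfrak{p}}(x_0/b))=1$. Let $f(x)=x^d-bx^m$, let $n\geq 0$, and let $\alpha\in f^{-n}(x_0)=\{\gamma\in\overline{K} : f^n(\gamma)=x_0\}$, where $f^n$ denotes the $n$-fold composition of $f$ with itself and $f^0(x)=x$. Suppose that $f^n(x)-x_0\in K[x]$ is irreducible over $K$. Then there are a prime $\mathfrak{P}$ of $K(\alpha)$ lying above $\mathfrak{p}$ and a prime $\mathfrak{Q}$ of $K(f^{-1}(\alpha))$, where $f^{-1}(\alpha)=\{\gamma\in\overline{K} : f(\gamma)=\alpha\}$, such that * $\mathfrak{P}$ has ramification index $m^n$ over $\mathfrak{p}$;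 * $m^n v_{\mathfrak{P}}(\alpha/b)$ is a positive integer relatively prime to $m$, where $v_{\mathfrak{P}}$ is the ($\mathbb{Q}$-valued) $\mathfrak{P}$-adic valuation on $K(\alpha)$ extending $v_{\mathfrak{p}}$; * $\mathfrak{Q}$ lies above $\mathfrak{P}$; * $f(x)-\alpha$ has $d$ distinct roots, and the inertia group $I(\mathfrak{Q}\mid\mathfrak{P})=\{\sigma\in\mathrm{Gal}(K(f^{-1}(\alpha))/K(\alpha)) : \sigma(x)\equiv x \pmod{\mathfrak{Q}} \text{ for all integers } x \text{ of } K(f^{-1}(\alpha))\}$ acts transitively on $m$ of these roots and fixes each of the other $d-m$ roots. -/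

import Mathlib

open NumberField IntermediateField Polynomial IsDedekindDomain

/-- The additive valuation `v_𝔭 : K → ℤ` attached to a prime `𝔭` of the ring of integers of `K`,
normalized so that a uniformizer has valuation `1`. Mathlib's `𝔭.valuation K` is multiplicative, with
`𝔭.valuation K x = exp (-v_𝔭(x))` for `x ≠ 0`. Only meaningful at `x ≠ 0` (the value at `0` is the
junk value `0`). -/
noncomputable def primeOrd {K : Type*} [Field K] [NumberField K]
    (𝔭 : HeightOneSpectrum (𝓞 K)) (x : K) : ℤ :=
  -WithZero.log (𝔭.valuation K x)

/-- For a finite extension `L / K` of number fields and a prime `𝔓` of `L`, the `𝔓`-adic valuation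
`v_𝔓 : L → ℚ`, normalized so that it extends the valuation `v_𝔭` of `K`, where `𝔭` is the prime of
`K` below `𝔓`: the normalized valuation of `𝔓` divided by the ramification index `e(𝔓 | 𝔭)`. -/
noncomputable def extendedOrd (K : Type*) {L : Type*} [Field K] [Field L] [NumberField L]
    [Algebra K L] (𝔓 : HeightOneSpectrum (𝓞 L)) (x : L) : ℚ :=
  (primeOrd 𝔓 x : ℚ) / (𝔓.asIdeal.ramificationIdx (𝓞 K) : ℚ)

/-- The trinomial `f(x) = x ^ d - b x ^ m`. -/
noncomputable def trinomialMap {K : Type*} [Field K] (d m : ℕ) (b : K) : K[X] :=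
  X ^ d - C b * X ^ m

/-- The `n`-th iterate `f ∘ f ∘ ⋯ ∘ f` of a polynomial `f`, with `f ^ 0 = x`. -/
noncomputable def polyIterate {K : Type*} [Field K] (f : K[X]) (n : ℕ) : K[X] :=
  f.comp^[n] X

/-- The fibre `f⁻ⁿ(y) = {γ ∈ Ω | fⁿ(γ) = y}` of the `n`-th iterate of `f`. -/
def iteratedFibre {K Ω : Type*} [Field K] [Field Ω] [Algebra K Ω] (f : K[X]) (n : ℕ) (y : Ω) :
    Set Ω :=
  {γ | aeval γ (polyIterate f n) = y}

/-- `K(α)` is a number field when `K` is one and `α` is algebraic over `K`. -/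
instance numberFieldAdjoinSimple {K Ω : Type*} [Field K] [NumberField K] [Field Ω] [Algebra K Ω]
    [Algebra.IsAlgebraic K Ω] (α : Ω) : NumberField K⟮α⟯ :=
  haveI : FiniteDimensional K K⟮α⟯ :=
    adjoin.finiteDimensional (Algebra.IsIntegral.isIntegral (R := K) α)
  NumberField.of_module_finite K K⟮α⟯

/-- The field `K(f⁻¹(α))` for a nonconstant `f ∈ K[x]`, as an extension of its subfield `K(α)`
(`α = f(γ) ∈ K(γ)` for every `γ ∈ f⁻¹(α)`, so that `K(α)(f⁻¹(α)) = K(f⁻¹(α))`). -/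
noncomputable abbrev fibreField {K Ω : Type*} [Field K] [Field Ω] [Algebra K Ω] (f : K[X]) (α : Ω) :
    IntermediateField K⟮α⟯ Ω :=
  adjoin K⟮α⟯ (iteratedFibre f 1 α)

/-! At a prime where `v(b)` is negative and smaller than `v(a)`, the Newton polygon of
`x ^ d - b x ^ m - a` has two slopes, giving `m` small roots and `d - m` big ones. Because
`(d - m) ∣ v(b)`, the big roots can be scaled to units by an element of the base field, and since
the residue characteristic does not divide `d - m` they are then pairwise incongruent. So inertia,
which moves them by something strictly smaller, fixes them. The product of the inertia orbit of a
small root lies in the inertia field, which is unramified over the base at the prime; as `v(a / b)`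
is prime to `m`, the length of the orbit is a multiple of `m`, so the orbit consists of all the
small roots. Sending `α` to a small root exhibits a prime of `K(α)` with ramification index `m` at
which `x ^ d - b x ^ m - α` satisfies the same hypotheses, and the argument is iterated. -/

section Trinomial

variable {E : Type*} [Field E] {d m : ℕ}

lemma monic_trinomialMap_sub_C (hmd : m < d) (a b : E) : (trinomialMap d m b - C a).Monic := by
  have hdeg : (C b * X ^ m + C a : E[X]).degree < d :=
    (degree_add_le _ _).trans_lt (max_lt
      ((degree_C_mul_X_pow_le m b).trans_lt (by exact_mod_cast hmd))
      (degree_C_le.trans_lt (by exact_mod_cast m.zero_le.trans_lt hmd)))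
  rw [trinomialMap, sub_sub]
  exact monic_X_pow_sub hdeg

lemma natDegree_trinomialMap (hmd : m < d) (b : E) : (trinomialMap d m b).natDegree = d := by
  rw [trinomialMap, natDegree_sub_eq_left_of_natDegree_lt] <;> rw [natDegree_X_pow]
  exact (natDegree_C_mul_X_pow_le b m).trans_lt hmd

lemma isRoot_trinomialMap_sub_C {a b γ : E} :
    (trinomialMap d m b - C a).IsRoot γ ↔ γ ^ d - b * γ ^ m = a := by
  simp [trinomialMap, sub_eq_zero]

lemma mem_roots_trinomialMap_sub_C (hmd : m < d) {a b γ : E} :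
    γ ∈ (trinomialMap d m b - C a).roots ↔ γ ^ d - b * γ ^ m = a := by
  rw [mem_roots (monic_trinomialMap_sub_C hmd a b).ne_zero, isRoot_trinomialMap_sub_C]

lemma finite_setOf_root (hmd : m < d) (a b : E) : {γ : E | γ ^ d - b * γ ^ m = a}.Finite :=
  (Multiset.finite_toSet (trinomialMap d m b - C a).roots).subset fun _ hγ ↦
    (mem_roots_trinomialMap_sub_C hmd).2 hγ

lemma root_ne_zero {a b γ : E} (hm : 0 < m) (hmd : m < d) (ha : a ≠ 0)
    (hγ : γ ^ d - b * γ ^ m = a) : γ ≠ 0 := by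
  rintro rfl
  exact ha (by simp [← hγ, hm.ne', (hm.trans hmd).ne'])

variable {A : Type*} [Field A] [Algebra E A]

lemma aeval_trinomialMap_sub_C_eq_zero_iff {a b : E} {γ : A} :
    aeval γ (trinomialMap d m b - C a) = 0 ↔
      γ ^ d - algebraMap E A b * γ ^ m = algebraMap E A a := by
  simp [trinomialMap, sub_eq_zero]

lemma minpoly_eq_trinomialMap_sub_C (hmd : m < d) {a b : E} {γ : A}
    (hγ : γ ^ d - algebraMap E A b * γ ^ m = algebraMap E A a)
    (hdeg : (minpoly E γ).natDegree = d) :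
    minpoly E γ = trinomialMap d m b - C a := by
  have hmonic := monic_trinomialMap_sub_C hmd a b
  have hint : IsIntegral E γ := ⟨_, hmonic, aeval_trinomialMap_sub_C_eq_zero_iff.2 hγ⟩
  refine (minpoly.unique_of_degree_le_degree_minpoly _ _ hmonic
    (aeval_trinomialMap_sub_C_eq_zero_iff.2 hγ) ?_).symm
  rw [degree_eq_natDegree hmonic.ne_zero, degree_eq_natDegree (minpoly.ne_zero hint),
    natDegree_sub_C, natDegree_trinomialMap hmd, hdeg]

lemma map_trinomialMap_sub_C {L : Type*} [Field L] (φ : E →+* L) (a b : E) :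
    (trinomialMap d m b - C a).map φ = trinomialMap d m (φ b) - C (φ a) := by
  simp [trinomialMap]

end Trinomial

section Valuation

variable {E Γ₀ : Type*} [Field E] [LinearOrderedCommGroupWithZero Γ₀] {v : Valuation E Γ₀}
  {d m : ℕ} {a b γ δ : E}

lemma root_eq_pow_mul (hmd : m < d) (hγ : γ ^ d - b * γ ^ m = a) :
    a = γ ^ m * (γ ^ (d - m) - b) := by
  rw [← hγ, mul_sub, ← pow_add, Nat.add_sub_of_le hmd.le, mul_comm b]

lemma map_small_root_pow (hmd : m < d) (hb : 1 < v b) (hγ : γ ^ d - b * γ ^ m = a)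
    (hsmall : v γ < 1) : v γ ^ m * v b = v a := by
  have hlt : v (γ ^ (d - m)) < v b := by
    rw [map_pow]
    exact (pow_le_one₀ zero_le hsmall.le).trans_lt hb
  rw [root_eq_pow_mul hmd hγ, map_mul, map_pow, v.map_sub_eq_of_lt_right hlt]

lemma map_big_root_pow_sub_lt (hmd : m < d) (hab : v a < v b) (hγ : γ ^ d - b * γ ^ m = a)
    (hbig : 1 ≤ v γ) : v (γ ^ (d - m) - b) < v b := by
  refine lt_of_le_of_lt ?_ hab
  rw [root_eq_pow_mul hmd hγ, map_mul, map_pow]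
  exact le_mul_of_one_le_left' (one_le_pow₀ hbig)

lemma map_big_root_pow (hmd : m < d) (hab : v a < v b) (hγ : γ ^ d - b * γ ^ m = a)
    (hbig : 1 ≤ v γ) : v γ ^ (d - m) = v b := by
  rw [← map_pow]
  exact v.map_eq_of_sub_lt (map_big_root_pow_sub_lt hmd hab hγ hbig)

lemma eq_of_pow_mul_pow_eq {A B : Γ₀} (hA : A ≠ 0) (hAB : A < B) {s t m n : ℕ}
    (hadd : s + t = m + n) (h : A ^ s * B ^ t = A ^ m * B ^ n) : s = m := by
  have hB : B ≠ 0 := (zero_le.trans_lt hAB).ne'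
  have hAB' : A / B < 1 := (div_lt_one₀ (zero_lt_iff.2 hB)).2 hAB
  have hscale (i j : ℕ) : (A / B) ^ i = A ^ i * B ^ j / B ^ (i + j) := by
    rw [pow_add, mul_div_mul_right _ _ (pow_ne_zero j hB), div_pow]
  refine pow_right_injective₀ (zero_lt_iff.2 (div_ne_zero hA hB)) hAB'.ne ?_
  simp only [hscale s t, hscale m n, h, hadd]

lemma prod_map_pow_eq_pow_card {ι A : Type*} [CommMonoid A] {s : Multiset ι} {f : ι → A} {k : ℕ}
    {c : A}
    (h : ∀ i ∈ s, f i ^ k = c) : (s.map f).prod ^ k = c ^ s.card := by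
  rw [← Multiset.prod_map_pow, Multiset.map_congr rfl h, Multiset.map_const',
    Multiset.prod_replicate]

lemma prod_map_roots (hm : 0 < m) (hmd : m < d) (hsplit : (trinomialMap d m b - C a).Splits) :
    ((trinomialMap d m b - C a).roots.map v).prod = v a := by
  have hcoeff : (trinomialMap d m b - C a).coeff 0 = -a := by
    simp [trinomialMap, hm.ne, (hm.trans hmd).ne]
  rw [Multiset.prod_hom, ← v.map_neg a, ← hcoeff,
    hsplit.coeff_zero_eq_prod_roots_of_monic (monic_trinomialMap_sub_C hmd a b)]
  simp

lemma map_pow_sub_one_lt {u : E} (hu : v (u - 1) < 1) (i : ℕ) : v (u ^ i - 1) < 1 := by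
  have hu1 : v u = 1 := by simpa using v.map_eq_of_sub_lt (x := 1) (y := u) (by simpa using hu)
  rw [← geom_sum_mul, map_mul]
  refine mul_lt_one_of_nonneg_of_lt_one_right (v.map_sum_le fun i _ ↦ ?_) zero_le hu
  simp [hu1]

lemma map_geom_sum₂_sub_lt {x : E} (hx : v (x - δ) < v δ) {k : ℕ} :
    v ((∑ i ∈ Finset.range k, x ^ i * δ ^ (k - 1 - i)) - k * δ ^ (k - 1)) < v δ ^ (k - 1) := by
  have hδ : 0 < v δ := zero_le.trans_lt hx
  have hδ0 : δ ≠ 0 := v.ne_zero_iff.1 hδ.ne'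
  have hu : v (x / δ - 1) < 1 := by
    rw [div_sub_one hδ0, map_div₀]
    exact (div_lt_one₀ hδ).2 hx
  have hterm : (∑ i ∈ Finset.range k, x ^ i * δ ^ (k - 1 - i)) - k * δ ^ (k - 1)
      = ∑ i ∈ Finset.range k, δ ^ (k - 1) * ((x / δ) ^ i - 1) := by
    simp only [mul_sub, Finset.sum_sub_distrib, mul_one, Finset.sum_const, Finset.card_range,
      nsmul_eq_mul]
    refine congrArg (· - _) (Finset.sum_congr rfl fun i hi ↦ ?_)
    have hi : i + (k - 1 - i) = k - 1 := by
      have := Finset.mem_range.1 hi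
      lia
    nth_rw 2 [← hi]
    rw [pow_add, div_pow]
    field_simp
  rw [hterm]
  refine v.map_sum_lt (pow_ne_zero _ hδ.ne') fun i _ ↦ ?_
  rw [map_mul, map_pow]
  exact mul_lt_of_lt_one_right (pow_pos hδ _) (map_pow_sub_one_lt hu i)

/-- The Newton polygon of `x ^ d - b x ^ m - a` at `v` has a vertex above `x ^ m`, separating `m`
small roots (`v γ < 1`) from `d - m` big ones (`1 ≤ v γ`), and `v (d - m) = 1`, which makes the big
roots simple modulo the maximal ideal after scaling. The valuation is multiplicative. -/
structure IsTwoSlope (v : Valuation E Γ₀) (d m : ℕ) (a b : E) : Prop where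
  pos : 0 < m
  lt : m < d
  ne_zero : a ≠ 0
  one_lt : 1 < v b
  map_lt : v a < v b
  map_natCast_sub : v ((d : E) - m) = 1

namespace IsTwoSlope

open Classical in
/-- The product of the roots has valuation `v a`, and the valuation of a root is determined by
whether it is small, so the number of small roots can be read off. -/
lemma card_filter_small_roots (h : IsTwoSlope v d m a b)
    (hsplit : (trinomialMap d m b - C a).Splits) :
    ((trinomialMap d m b - C a).roots.filter (v · < 1)).card = m := by
  obtain ⟨hm, hmd, ha, hb, hab, -⟩ := h
  set g := trinomialMap d m b - C a with hg
  have hdeg : g.natDegree = d := by rw [hg, natDegree_sub_C, natDegree_trinomialMap hmd]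
  set S := g.roots.filter (v · < 1)
  set T := g.roots.filter (¬ v · < 1)
  have hST : S + T = g.roots := Multiset.filter_add_not _ _
  have hcard : S.card + T.card = m + (d - m) := by
    rw [← Multiset.card_add, hST, ← hsplit.natDegree_eq_card_roots, hdeg,
      Nat.add_sub_of_le hmd.le]
  have hprod : (S.map v).prod * (T.map v).prod = v a := by
    rw [← Multiset.prod_add, ← Multiset.map_add, hST, prod_map_roots hm hmd hsplit]
  have hb0 : v b ≠ 0 := (zero_lt_one.trans hb).ne'
  have hSprod : (S.map v).prod ^ m = (v a / v b) ^ S.card := by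
    refine prod_map_pow_eq_pow_card fun γ hγ ↦ ?_
    obtain ⟨hγ, hsmall⟩ := Multiset.mem_filter.1 hγ
    rw [mem_roots_trinomialMap_sub_C hmd] at hγ
    exact eq_div_of_mul_eq hb0 (map_small_root_pow hmd hb hγ hsmall)
  have hTprod : (T.map v).prod ^ (d - m) = v b ^ T.card := by
    refine prod_map_pow_eq_pow_card fun γ hγ ↦ ?_
    obtain ⟨hγ, hbig⟩ := Multiset.mem_filter.1 hγ
    rw [mem_roots_trinomialMap_sub_C hmd] at hγ
    exact map_big_root_pow hmd hab hγ (not_lt.1 hbig)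
  have hlt : (v a / v b) ^ (d - m) < v b ^ m :=
    (pow_lt_one₀ zero_le ((div_lt_one₀ (zero_lt_iff.2 hb0)).2 hab)
      (Nat.sub_ne_zero_of_lt hmd)).trans (one_lt_pow₀ hb hm.ne')
  refine eq_of_pow_mul_pow_eq (pow_ne_zero _ (div_ne_zero (v.ne_zero_iff.2 ha) hb0)) hlt hcard ?_
  calc ((v a / v b) ^ (d - m)) ^ S.card * (v b ^ m) ^ T.card
    _ = ((S.map v).prod ^ m) ^ (d - m) * ((T.map v).prod ^ (d - m)) ^ m := by
      rw [hSprod, hTprod, pow_right_comm, pow_right_comm (v b)]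
    _ = (v a ^ m) ^ (d - m) := by rw [pow_right_comm _ (d - m), ← mul_pow, ← mul_pow, hprod]
    _ = ((v a / v b) ^ (d - m)) ^ m * (v b ^ m) ^ (d - m) := by
      rw [pow_right_comm _ (d - m), ← mul_pow, ← mul_pow, div_mul_cancel₀ _ hb0]

lemma map_geom_sum₂_sub_mul_geom_sum₂ (h : IsTwoSlope v d m a b)
    (hδ : δ ^ d - b * δ ^ m = a) (hbig : 1 ≤ v δ) {x : E} (hx : v (x - δ) < v δ) :
    v (∑ i ∈ Finset.range d, x ^ i * δ ^ (d - 1 - i) -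
      b * ∑ i ∈ Finset.range m, x ^ i * δ ^ (m - 1 - i)) = v δ ^ (d - 1) := by
  obtain ⟨hm, hmd, -, -, hab, hdm⟩ := h
  have hd := map_geom_sum₂_sub_lt hx (k := d)
  have hm' := map_geom_sum₂_sub_lt hx (k := m)
  set A := ∑ i ∈ Finset.range d, x ^ i * δ ^ (d - 1 - i)
  set B := ∑ i ∈ Finset.range m, x ^ i * δ ^ (m - 1 - i)
  have hδm : v b * v δ ^ (m - 1) = v δ ^ (d - 1) := by
    rw [← map_big_root_pow hmd hab hδ hbig, ← pow_add, show d - m + (m - 1) = d - 1 by lia]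
  have hmain : v ((d - m) * δ ^ (d - 1)) = v δ ^ (d - 1) := by
    rw [map_mul, hdm, one_mul, map_pow]
  have hdecomp : A - b * B - (d - m) * δ ^ (d - 1) = (A - d * δ ^ (d - 1))
      - b * (B - m * δ ^ (m - 1)) + m * (δ ^ (m - 1) * (δ ^ (d - m) - b)) := by
    rw [mul_sub (δ ^ (m - 1)), ← pow_add, show m - 1 + (d - m) = d - 1 by lia]
    ring
  have hclose : v (A - b * B - (d - m) * δ ^ (d - 1)) < v δ ^ (d - 1) := by
    rw [hdecomp]
    refine v.map_add_lt (v.map_sub_lt hd ?_) ?_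
    · rw [map_mul, ← hδm]
      exact mul_lt_mul_of_pos_left hm' (zero_le.trans_lt hab)
    · have hm1 : v (m : E) ≤ 1 := natCast_mem v.integer m
      rw [map_mul, map_mul, map_pow, ← hδm, mul_comm (v b)]
      exact (mul_le_of_le_one_left' hm1).trans_lt
        (mul_lt_mul_of_pos_left (map_big_root_pow_sub_lt hmd hab hδ hbig)
          (pow_pos (zero_lt_one.trans_le hbig) _))
  rw [v.map_eq_of_sub_lt (hmain ▸ hclose), hmain]

/-- A Hensel-type separation: a big root is simple, and no other root lies closer to it than
its own absolute value. -/
lemma exists_cofactor_of_big_root (h : IsTwoSlope v d m a b)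
    (hδ : δ ^ d - b * δ ^ m = a) (hbig : 1 ≤ v δ) :
    ∃ q : E[X], trinomialMap d m b - C a = (X - C δ) * q ∧
      ∀ x, v (x - δ) < v δ → q.eval x ≠ 0 := by
  refine ⟨∑ i ∈ Finset.range d, X ^ i * C δ ^ (d - 1 - i)
    - C b * ∑ i ∈ Finset.range m, X ^ i * C δ ^ (m - 1 - i), ?_, fun x hx ↦ ?_⟩
  · rw [mul_sub, mul_left_comm, mul_comm (X - C δ), mul_comm (X - C δ), geom_sum₂_mul,
      geom_sum₂_mul, ← hδ, trinomialMap]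
    simp only [C_sub, C_mul, C_pow]
    ring
  · rw [eval_sub, eval_mul, eval_C, eval_finsetSum, eval_finsetSum]
    simp only [eval_mul, eval_pow, eval_X, eval_C]
    rw [← v.ne_zero_iff, h.map_geom_sum₂_sub_mul_geom_sum₂ hδ hbig hx]
    exact pow_ne_zero _ (zero_lt_one.trans_le hbig).ne'

lemma eq_big_root_of_sub_lt (h : IsTwoSlope v d m a b)
    (hδ : δ ^ d - b * δ ^ m = a) (hbig : 1 ≤ v δ) (hγ : γ ^ d - b * γ ^ m = a)
    (hlt : v (γ - δ) < v δ) : γ = δ := by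
  obtain ⟨q, hfactor, hne⟩ := h.exists_cofactor_of_big_root hδ hbig
  have hroot := isRoot_trinomialMap_sub_C.2 hγ
  rw [hfactor, root_mul, root_X_sub_C] at hroot
  exact (hroot.resolve_right (hne γ hlt)).symm

open Classical in
lemma count_big_root (h : IsTwoSlope v d m a b) (hδ : δ ^ d - b * δ ^ m = a) (hbig : 1 ≤ v δ) :
    (trinomialMap d m b - C a).roots.count δ = 1 := by
  obtain ⟨q, hfactor, hne⟩ := h.exists_cofactor_of_big_root hδ hbig
  have hδ0 : 0 < v δ := zero_lt_one.trans_le hbig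
  have hg := (monic_trinomialMap_sub_C h.lt a b).ne_zero
  rw [hfactor] at hg ⊢
  rw [roots_mul hg, roots_X_sub_C, Multiset.count_add, Multiset.count_singleton_self,
    Multiset.count_eq_zero_of_notMem fun hmem ↦
      hne δ (by simpa using hδ0) (isRoot_of_mem_roots hmem)]

lemma exists_small_root (h : IsTwoSlope v d m a b) (hsplit : (trinomialMap d m b - C a).Splits) :
    ∃ γ : E, γ ^ d - b * γ ^ m = a ∧ v γ < 1 := by
  classical
  obtain ⟨γ, hγ⟩ := Multiset.card_pos_iff_exists_mem.1
    (h.pos.trans_eq (h.card_filter_small_roots hsplit).symm)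
  obtain ⟨hroot, hsmall⟩ := Multiset.mem_filter.1 hγ
  exact ⟨γ, (mem_roots_trinomialMap_sub_C h.lt).1 hroot, hsmall⟩

lemma ncard_small_roots_le (h : IsTwoSlope v d m a b) (hsplit : (trinomialMap d m b - C a).Splits) :
    {γ : E | γ ^ d - b * γ ^ m = a ∧ v γ < 1}.ncard ≤ m := by
  classical
  have hset : {γ : E | γ ^ d - b * γ ^ m = a ∧ v γ < 1}
      = ((trinomialMap d m b - C a).roots.filter (v · < 1)).toFinset := by
    ext γ
    simp only [Set.mem_ofPred_eq, Finset.mem_coe, Multiset.mem_toFinset, Multiset.mem_filter,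
      mem_roots_trinomialMap_sub_C h.lt]
  rw [hset, Set.ncard_coe_finset]
  exact (Multiset.toFinset_card_le _).trans_eq (h.card_filter_small_roots hsplit)

lemma ncard_big_roots (h : IsTwoSlope v d m a b) (hsplit : (trinomialMap d m b - C a).Splits) :
    {γ : E | γ ^ d - b * γ ^ m = a ∧ 1 ≤ v γ}.ncard = d - m := by
  classical
  set T := (trinomialMap d m b - C a).roots.filter (¬ v · < 1) with hT
  have hset : {γ : E | γ ^ d - b * γ ^ m = a ∧ 1 ≤ v γ} = T.toFinset := by
    ext γ
    simp only [hT, Set.mem_ofPred_eq, Finset.mem_coe, Multiset.mem_toFinset, Multiset.mem_filter,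
      mem_roots_trinomialMap_sub_C h.lt, not_lt]
  have hnodup : T.Nodup := by
    refine Multiset.nodup_iff_count_le_one.2 fun δ ↦ ?_
    by_cases hδ : δ ∈ T
    · obtain ⟨hroot, hbig⟩ := Multiset.mem_filter.1 hδ
      rw [hT, Multiset.count_filter_of_pos (p := (¬ v · < 1)) hbig, h.count_big_root
        ((mem_roots_trinomialMap_sub_C h.lt).1 hroot) (not_lt.1 hbig)]
    · simp [Multiset.count_eq_zero_of_notMem hδ]
  have hcard := congrArg Multiset.card (Multiset.filter_add_not (v · < 1)
    (trinomialMap d m b - C a).roots)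
  rw [Multiset.card_add, h.card_filter_small_roots hsplit, ← hsplit.natDegree_eq_card_roots,
    natDegree_sub_C, natDegree_trinomialMap h.lt] at hcard
  rw [hset, Set.ncard_coe_finset, Multiset.toFinset_card_of_nodup hnodup]
  lia

end IsTwoSlope

end Valuation

section Inertia

lemma exists_liesOver {F : Type*} (M : Type*) [Field F] [Field M] [Algebra F M]
    (P : HeightOneSpectrum (𝓞 F)) :
    ∃ Q : HeightOneSpectrum (𝓞 M), Q.asIdeal.LiesOver P.asIdeal := by
  have := P.isPrime
  obtain ⟨⟨Q, hQ⟩⟩ := P.asIdeal.nonempty_primesOver (S := 𝓞 M)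
  exact ⟨⟨Q, hQ.1, Ideal.ne_bot_of_mem_primesOver P.ne_bot hQ⟩, hQ.2⟩

lemma apply_algebraMap_of_adjoin_eq_top {F L M : Type*} [Field F] [Field L] [Field M]
    [Algebra F L] [Algebra F M] [Algebra L M] [IsScalarTower F L M] [Algebra.IsAlgebraic F L]
    {σ : Gal(M/F)} {x : L} (hx : F⟮x⟯ = ⊤) (hσ : σ (algebraMap L M x) = algebraMap L M x) (y : L) :
    σ (algebraMap L M y) = algebraMap L M y := by
  have hadjoin : Algebra.adjoin F {x} = ⊤ := Algebra.adjoin_eq_top_of_intermediateField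
    (by simpa using Algebra.IsAlgebraic.isAlgebraic x) hx
  exact DFunLike.congr_fun (AlgHom.ext_of_adjoin_eq_top (φ₁ := (σ : M →ₐ[F] M).comp
    (IsScalarTower.toAlgHom F L M)) (φ₂ := IsScalarTower.toAlgHom F L M) hadjoin
    (by simpa using hσ)) y

variable {F M : Type*} [Field F] [Field M] [Algebra F M] [NumberField M]
  {Q : HeightOneSpectrum (𝓞 M)} {σ : Gal(M/F)}

lemma valuation_sub_lt_one_of_mem_inertia (hσ : σ ∈ Q.asIdeal.inertia Gal(M/F)) {y : M}
    (hy : Q.valuation M y ≤ 1) : Q.valuation M (σ y - y) < 1 := by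
  obtain ⟨r, ⟨s, hs⟩, hrs⟩ := HeightOneSpectrum.exists_primeCompl_mul_eq_of_integer Q y hy
  have hmem (x : 𝓞 M) : σ • x - x ∈ Q.asIdeal := hσ x
  have hσs : σ • s ∉ Q.asIdeal := fun h ↦ hs (by simpa using Q.asIdeal.sub_mem h (hmem s))
  have hσrs : σ y * algebraMap (𝓞 M) M (σ • s) = algebraMap (𝓞 M) M (σ • r) := by
    change σ y * σ (algebraMap (𝓞 M) M s) = σ (algebraMap (𝓞 M) M r)
    rw [← map_mul, hrs]
  have hclear : (σ y - y) * algebraMap (𝓞 M) M (σ • s) * algebraMap (𝓞 M) M s =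
      algebraMap (𝓞 M) M ((σ • r - r) * s - r * (σ • s - s)) := by
    simp only [map_sub, map_mul]
    linear_combination algebraMap (𝓞 M) M s * hσrs - algebraMap (𝓞 M) M (σ • s) * hrs
  have hlt : Q.valuation M (algebraMap (𝓞 M) M ((σ • r - r) * s - r * (σ • s - s))) < 1 :=
    (Q.valuation_lt_one_iff_mem _).2
      (Q.asIdeal.sub_mem (Q.asIdeal.mul_mem_right s (hmem r)) (Q.asIdeal.mul_mem_left r (hmem s)))
  rwa [← hclear, map_mul, map_mul, Q.valuation_eq_one_iff_notMem.2 hs,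
    Q.valuation_eq_one_iff_notMem.2 hσs, mul_one, mul_one] at hlt

lemma valuation_sub_lt_of_mem_inertia (hσ : σ ∈ Q.asIdeal.inertia Gal(M/F)) {y : M} {c : F}
    (hc : c ≠ 0) (hy : Q.valuation M y ≤ Q.valuation M (algebraMap F M c)) :
    Q.valuation M (σ y - y) < Q.valuation M (algebraMap F M c) := by
  have hc0 : algebraMap F M c ≠ 0 := by simpa using hc
  have hpos : 0 < Q.valuation M (algebraMap F M c) :=
    zero_lt_iff.2 ((Q.valuation M).ne_zero_iff.2 hc0)
  have hlt := valuation_sub_lt_one_of_mem_inertia hσ (y := y / algebraMap F M c)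
    (by rw [map_div₀]; exact (div_le_one₀ hpos).2 hy)
  rwa [map_div₀, AlgEquiv.commutes, ← sub_div, map_div₀, div_lt_one₀ hpos] at hlt

variable [NumberField F]

lemma valuation_algebraMap (P : HeightOneSpectrum (𝓞 F)) (Q : HeightOneSpectrum (𝓞 M))
    [Q.asIdeal.LiesOver P.asIdeal] (x : F) :
    Q.valuation M (algebraMap F M x) = P.valuation F x ^ Q.asIdeal.ramificationIdx (𝓞 F) := by
  rw [← HeightOneSpectrum.valuation_liesOver M P Q,
    Ideal.ramificationIdx'_eq_ramificationIdx _ _ P.ne_bot]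

lemma ramificationIdx_ne_zero (Q : HeightOneSpectrum (𝓞 M)) :
    Q.asIdeal.ramificationIdx (𝓞 F) ≠ 0 :=
  have := Q.isPrime
  (Ideal.ramificationIdx_pos _ _).ne'

lemma ramificationIdx_eq_one_of_surjective (hsurj : Function.Surjective (algebraMap F M))
    (Q : HeightOneSpectrum (𝓞 M)) : Q.asIdeal.ramificationIdx (𝓞 F) = 1 := by
  have : Q.asIdeal.LiesOver (Q.under (𝓞 F)).asIdeal := ⟨rfl⟩
  obtain ⟨y, hy⟩ := Q.valuation_surjective M (WithZero.exp 1)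
  obtain ⟨x, rfl⟩ := hsurj y
  rw [valuation_algebraMap (Q.under (𝓞 F))] at hy
  have hlog := congrArg WithZero.log hy
  rw [WithZero.log_pow, WithZero.log_exp, nsmul_eq_mul] at hlog
  exact Nat.dvd_one.1 (Int.natCast_dvd_natCast.1 ⟨_, hlog.symm⟩)

lemma valuation_eq_of_mem_inertia (hσ : σ ∈ Q.asIdeal.inertia Gal(M/F)) (y : M) :
    Q.valuation M (σ y) = Q.valuation M y := by
  obtain rfl | hy := eq_or_ne y 0
  · rw [map_zero]
  have : Q.asIdeal.LiesOver (Q.under (𝓞 F)).asIdeal := ⟨rfl⟩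
  set e := Q.asIdeal.ramificationIdx (𝓞 F)
  obtain ⟨c, hc⟩ := (Q.under (𝓞 F)).valuation_surjective F (Q.valuation M y)
  have hc0 : c ≠ 0 := by
    rw [← ((Q.under (𝓞 F)).valuation F).ne_zero_iff, hc]
    exact (Q.valuation M).ne_zero_iff.2 hy
  have hcy : Q.valuation M (algebraMap F M c) = Q.valuation M (y ^ e) := by
    rw [valuation_algebraMap (Q.under (𝓞 F)), hc, map_pow]
  have hpow := (Q.valuation M).map_eq_of_sub_lt
    (hcy ▸ valuation_sub_lt_of_mem_inertia hσ hc0 hcy.ge)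
  rw [map_pow, map_pow, map_pow] at hpow
  exact (pow_left_inj₀ zero_le zero_le (ramificationIdx_ne_zero Q)).1 hpow

lemma card_inertia_eq_ramificationIdx {G : Type*} [Group G] [Finite G]
    [MulSemiringAction G (𝓞 M)] [IsGaloisGroup G (𝓞 F) (𝓞 M)] (Q : HeightOneSpectrum (𝓞 M)) :
    Nat.card (Q.asIdeal.inertia G) = Q.asIdeal.ramificationIdx (𝓞 F) := by
  have := Q.isMaximal
  have := (Q.under (𝓞 F)).isMaximal
  have : Q.asIdeal.LiesOver (Q.under (𝓞 F)).asIdeal := ⟨rfl⟩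
  have : Finite (𝓞 F ⧸ (Q.under (𝓞 F)).asIdeal) :=
    Ring.HasFiniteQuotients.finiteQuotient (Q.under (𝓞 F)).ne_bot
  rw [Ideal.card_inertia_eq_ramificationIdxIn (Q.under (𝓞 F)).asIdeal Q.asIdeal,
    Ideal.ramificationIdxIn_eq_ramificationIdx _ Q.asIdeal G]

/-- The extension `M` of the inertia field is totally ramified at `Q`, of degree
`e(Q | Q ∩ F)`. -/
lemma ramificationIdx_dvd_log_valuation [IsGalois F M] {z : M}
    (hz : ∀ σ ∈ Q.asIdeal.inertia Gal(M/F), σ z = z) :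
    (Q.asIdeal.ramificationIdx (𝓞 F) : ℤ) ∣ WithZero.log (Q.valuation M z) := by
  let I := Q.asIdeal.inertia Gal(M/F)
  let E : IntermediateField F M := FixedPoints.intermediateField I
  have : NumberField E := .of_intermediateField E
  have : IsGaloisGroup I E M := .subgroup Gal(M/F) F M I
  have : IsGaloisGroup I (𝓞 E) (𝓞 M) := .of_isFractionRing I (𝓞 E) (𝓞 M) E M
  have : IsGaloisGroup Gal(M/F) (𝓞 F) (𝓞 M) := .of_isFractionRing _ (𝓞 F) (𝓞 M) F M
  have htop : Q.asIdeal.inertia I = ⊤ := top_unique fun σ _ ↦ Ideal.coe_mem_inertia.1 σ.2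
  have hram : Q.asIdeal.ramificationIdx (𝓞 E) = Q.asIdeal.ramificationIdx (𝓞 F) := by
    rw [← card_inertia_eq_ramificationIdx (G := I), htop, Subgroup.card_top,
      ← card_inertia_eq_ramificationIdx (G := Gal(M/F))]
  have : Q.asIdeal.LiesOver (Q.under (𝓞 E)).asIdeal := ⟨rfl⟩
  have hzE := valuation_algebraMap (Q.under (𝓞 E)) Q ⟨z, fun σ ↦ hz σ.1 σ.2⟩
  rw [hram] at hzE
  exact ⟨_, by simpa using congrArg WithZero.log hzE⟩

/-- The product of the orbit is fixed by inertia. -/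
lemma dvd_ncard_orbit_inertia [IsGalois F M] (P : HeightOneSpectrum (𝓞 F))
    [Q.asIdeal.LiesOver P.asIdeal] {m : ℕ} {γ : M} {c : F}
    (hγ : Q.valuation M γ ^ m = Q.valuation M (algebraMap F M c))
    (hcop : IsCoprime (m : ℤ) (WithZero.log (P.valuation F c))) :
    m ∣ (MulAction.orbit (Q.asIdeal.inertia Gal(M/F)) γ).ncard := by
  set I := Q.asIdeal.inertia Gal(M/F)
  have : FiniteDimensional F M := Module.Finite.of_restrictScalars_finite ℚ F M
  have : Finite (MulAction.orbit I γ) := Finite.finite_mulAction_orbit γ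
  have := Fintype.ofFinite (MulAction.orbit I γ)
  set N := (MulAction.orbit I γ).ncard with hN
  set z : M := ∏ x : MulAction.orbit I γ, (x : M) with hz
  have hfixed (σ : Gal(M/F)) (hσ : σ ∈ I) : σ z = z := by
    rw [hz, map_prod]
    exact Equiv.prod_comp (MulAction.toPerm (⟨σ, hσ⟩ : I)) fun x : MulAction.orbit I γ ↦ (x : M)
  have hval : Q.valuation M z = Q.valuation M γ ^ N := by
    have hconst (x : MulAction.orbit I γ) : Q.valuation M x = Q.valuation M γ := by
      obtain ⟨_, σ, rfl⟩ := x
      exact valuation_eq_of_mem_inertia σ.2 γ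
    rw [hz, map_prod, Finset.prod_eq_pow_card fun x _ ↦ hconst x, Finset.card_univ, hN,
      ← Nat.card_coe_set_eq, Nat.card_eq_fintype_card]
  obtain ⟨k, hk⟩ := ramificationIdx_dvd_log_valuation hfixed
  rw [hval, WithZero.log_pow, nsmul_eq_mul] at hk
  have hlog := congrArg WithZero.log hγ
  rw [valuation_algebraMap P, WithZero.log_pow, WithZero.log_pow, nsmul_eq_mul, nsmul_eq_mul]
    at hlog
  have he : (Q.asIdeal.ramificationIdx (𝓞 F) : ℤ) ≠ 0 := by
    exact_mod_cast ramificationIdx_ne_zero Q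
  refine Int.natCast_dvd_natCast.1 (hcop.dvd_of_dvd_mul_right ⟨k, mul_left_cancel₀ he ?_⟩)
  linear_combination (m : ℤ) * hk - N * hlog

lemma ncard_orbit_inertia_eq_ramificationIdx [IsGalois F M] {L : Type*} [Field L] [NumberField L]
    [Algebra F L] [Algebra L M] [IsScalarTower F L M] (q : HeightOneSpectrum (𝓞 L))
    [Q.asIdeal.LiesOver q.asIdeal] {x : L} (hx : F⟮x⟯ = ⊤) :
    (MulAction.orbit (Q.asIdeal.inertia Gal(M/F)) (algebraMap L M x)).ncard =
      q.asIdeal.ramificationIdx (𝓞 F) := by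
  set I := Q.asIdeal.inertia Gal(M/F)
  have : FiniteDimensional F M := Module.Finite.of_restrictScalars_finite ℚ F M
  have : FiniteDimensional F L := Module.Finite.of_restrictScalars_finite ℚ F L
  have : FiniteDimensional L M := Module.Finite.of_restrictScalars_finite ℚ L M
  have : IsGalois L M := IsGalois.tower_top_of_isGalois F L M
  have : IsGaloisGroup Gal(M/F) (𝓞 F) (𝓞 M) := .of_isFractionRing _ (𝓞 F) (𝓞 M) F M
  have : IsGaloisGroup Gal(M/L) (𝓞 L) (𝓞 M) := .of_isFractionRing _ (𝓞 L) (𝓞 M) L M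
  have hstab : Nat.card (Q.asIdeal.inertia Gal(M/L)) =
      Nat.card (MulAction.stabilizer I (algebraMap L M x)) := by
    refine Nat.card_congr
      { toFun τ := ⟨⟨τ.1.restrictScalars F, fun r ↦ τ.2 r⟩, τ.1.commutes x⟩
        invFun σ := ⟨.ofRingEquiv (f := (σ.1.1 : M ≃+* M))
          (apply_algebraMap_of_adjoin_eq_top hx σ.2), fun r ↦ σ.1.2 r⟩
        left_inv _ := rfl
        right_inv _ := rfl }
  have htower := Ideal.ramificationIdx_tower (R := 𝓞 F) q.asIdeal Q.asIdeal
  have hindex := Subgroup.card_mul_index (MulAction.stabilizer I (algebraMap L M x))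
  rw [MulAction.index_stabilizer, ← hstab, card_inertia_eq_ramificationIdx (F := L),
    card_inertia_eq_ramificationIdx (F := F), htower, mul_comm] at hindex
  exact Nat.eq_of_mul_eq_mul_right (Nat.pos_of_ne_zero (ramificationIdx_ne_zero Q)) hindex

end Inertia

section RamifiedTrinomial

/-- The hypotheses on `x ^ d - b x ^ m - a` at a prime `P` under which inertia above `P` permutes
the small roots transitively and fixes the big ones: the Newton polygon is as in `IsTwoSlope`, its
slope at the big roots is integral, and its slope at the small roots has denominator exactly `m`. -/
structure IsRamifiedTrinomial {F : Type*} [Field F] [NumberField F] (P : HeightOneSpectrum (𝓞 F))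
    (d m : ℕ) (a b : F) : Prop extends IsTwoSlope (P.valuation F) d m a b where
  exists_pow_eq : ∃ c, P.valuation F c ^ (d - m) = P.valuation F b
  isCoprime : IsCoprime (m : ℤ) (WithZero.log (P.valuation F (a / b)))

variable {F M : Type*} [Field F] [NumberField F] [Field M] [NumberField M] [Algebra F M]
  {P : HeightOneSpectrum (𝓞 F)} {Q : HeightOneSpectrum (𝓞 M)} [Q.asIdeal.LiesOver P.asIdeal]
  {d m : ℕ} {a b : F} {γ δ : M}

lemma IsTwoSlope.map_algebraMap (h : IsTwoSlope (P.valuation F) d m a b) :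
    IsTwoSlope (Q.valuation M) d m (algebraMap F M a) (algebraMap F M b) where
  pos := h.pos
  lt := h.lt
  ne_zero := by simpa using h.ne_zero
  one_lt := by
    rw [valuation_algebraMap P]
    exact one_lt_pow₀ h.one_lt (ramificationIdx_ne_zero Q)
  map_lt := by
    rw [valuation_algebraMap P, valuation_algebraMap P]
    exact pow_lt_pow_left₀ h.map_lt zero_le (ramificationIdx_ne_zero Q)
  map_natCast_sub := by
    rw [← map_natCast (algebraMap F M), ← map_natCast (algebraMap F M), ← map_sub,
      valuation_algebraMap P, h.map_natCast_sub, one_pow]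

namespace IsRamifiedTrinomial

lemma inertia_fixes_big_root (h : IsRamifiedTrinomial P d m a b)
    (hδ : δ ^ d - algebraMap F M b * δ ^ m = algebraMap F M a) (hbig : 1 ≤ Q.valuation M δ)
    {σ : Gal(M/F)} (hσ : σ ∈ Q.asIdeal.inertia Gal(M/F)) : σ δ = δ := by
  have hQ : IsTwoSlope (Q.valuation M) d m (algebraMap F M a) (algebraMap F M b) :=
    h.toIsTwoSlope.map_algebraMap
  obtain ⟨c, hc⟩ := h.exists_pow_eq
  have hδc : Q.valuation M δ = Q.valuation M (algebraMap F M c) := by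
    refine (pow_left_inj₀ zero_le zero_le (Nat.sub_ne_zero_of_lt h.lt)).1 ?_
    rw [map_big_root_pow hQ.lt hQ.map_lt hδ hbig, ← map_pow, ← map_pow, valuation_algebraMap P,
      valuation_algebraMap P, map_pow, hc]
  have hc0 : c ≠ 0 := by
    rintro rfl
    simp [hδc] at hbig
  refine hQ.eq_big_root_of_sub_lt hδ hbig ?_
    (hδc ▸ valuation_sub_lt_of_mem_inertia hσ hc0 hδc.le)
  simpa using congrArg σ hδ

variable [IsGalois F M]

lemma orbit_small_root (h : IsRamifiedTrinomial P d m a b)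
    (hsplit : ((trinomialMap d m b - C a).map (algebraMap F M)).Splits)
    (hγ : γ ^ d - algebraMap F M b * γ ^ m = algebraMap F M a) (hsmall : Q.valuation M γ < 1) :
    MulAction.orbit (Q.asIdeal.inertia Gal(M/F)) γ =
        {δ | δ ^ d - algebraMap F M b * δ ^ m = algebraMap F M a ∧ Q.valuation M δ < 1} ∧
      (MulAction.orbit (Q.asIdeal.inertia Gal(M/F)) γ).ncard = m := by
  have hQ : IsTwoSlope (Q.valuation M) d m (algebraMap F M a) (algebraMap F M b) :=
    h.toIsTwoSlope.map_algebraMap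
  rw [map_trinomialMap_sub_C] at hsplit
  set I := Q.asIdeal.inertia Gal(M/F)
  set S := {δ | δ ^ d - algebraMap F M b * δ ^ m = algebraMap F M a ∧ Q.valuation M δ < 1}
  have hsub : MulAction.orbit I γ ⊆ S := by
    rintro _ ⟨⟨σ, hσ⟩, rfl⟩
    change σ γ ∈ S
    exact ⟨by simpa using congrArg σ hγ, (valuation_eq_of_mem_inertia hσ γ).trans_lt hsmall⟩
  have hdvd : m ∣ (MulAction.orbit I γ).ncard := by
    refine dvd_ncard_orbit_inertia P ?_ h.isCoprime
    rw [map_div₀, map_div₀, ← map_small_root_pow hQ.lt hQ.one_lt hγ hsmall,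
      mul_div_cancel_right₀ _ (zero_lt_one.trans hQ.one_lt).ne']
  have hfin : S.Finite := (finite_setOf_root hQ.lt _ _).subset fun _ hδ ↦ hδ.1
  have hle := Nat.le_of_dvd ((Set.ncard_pos (hfin.subset hsub)).2 (MulAction.nonempty_orbit γ)) hdvd
  have heq := Set.eq_of_subset_of_ncard_le hsub ((hQ.ncard_small_roots_le hsplit).trans hle) hfin
  exact ⟨heq, le_antisymm (heq ▸ hQ.ncard_small_roots_le hsplit) hle⟩

lemma exists_inertia_orbit_union_fixed (h : IsRamifiedTrinomial P d m a b)
    (hsplit : ((trinomialMap d m b - C a).map (algebraMap F M)).Splits) :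
    ∃ S T : Set M, S ∪ T = {γ | γ ^ d - algebraMap F M b * γ ^ m = algebraMap F M a} ∧
      Disjoint S T ∧ S.ncard = m ∧ T.ncard = d - m ∧
      (∀ σ ∈ Q.asIdeal.inertia Gal(M/F), ∀ γ ∈ S, σ γ ∈ S) ∧
      (∀ γ ∈ S, ∀ δ ∈ S, ∃ σ ∈ Q.asIdeal.inertia Gal(M/F), σ γ = δ) ∧
      ∀ σ ∈ Q.asIdeal.inertia Gal(M/F), ∀ γ ∈ T, σ γ = γ := by
  have hQ : IsTwoSlope (Q.valuation M) d m (algebraMap F M a) (algebraMap F M b) :=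
    h.toIsTwoSlope.map_algebraMap
  have hsplit' := map_trinomialMap_sub_C (algebraMap F M) a b ▸ hsplit
  obtain ⟨γ₀, hγ₀, hsmall⟩ := hQ.exists_small_root hsplit'
  obtain ⟨hS, hcard⟩ := h.orbit_small_root hsplit hγ₀ hsmall
  refine ⟨MulAction.orbit (Q.asIdeal.inertia Gal(M/F)) γ₀,
    {γ | γ ^ d - algebraMap F M b * γ ^ m = algebraMap F M a ∧ 1 ≤ Q.valuation M γ},
    ?_, ?_, hcard, hQ.ncard_big_roots hsplit', fun σ hσ γ hγ ↦ ?_, fun γ hγ δ hδ ↦ ?_,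
    fun σ hσ γ hγ ↦ h.inertia_fixes_big_root hγ.1 hγ.2 hσ⟩
  · rw [hS]
    ext γ
    simp only [Set.mem_union, Set.mem_ofPred_eq, ← and_or_left, lt_or_ge, and_true]
  · rw [hS]
    exact Set.disjoint_left.2 fun γ hγ hγ' ↦ hγ.2.not_ge hγ'.2
  · exact MulAction.mem_orbit_of_mem_orbit ⟨σ, hσ⟩ hγ
  · rw [← MulAction.orbit_eq_iff.2 hγ] at hδ
    obtain ⟨σ, hσ⟩ := hδ
    exact ⟨σ.1, σ.2, hσ⟩

lemma of_small_root {L : Type*} [Field L] [NumberField L] [Algebra F L]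
    (h : IsRamifiedTrinomial P d m a b) {q : HeightOneSpectrum (𝓞 L)} [q.asIdeal.LiesOver P.asIdeal]
    (hram : q.asIdeal.ramificationIdx (𝓞 F) = m) {γ : L}
    (hγ : γ ^ d - algebraMap F L b * γ ^ m = algebraMap F L a) (hsmall : q.valuation L γ < 1) :
    IsRamifiedTrinomial q d m γ (algebraMap F L b) := by
  have hq : IsTwoSlope (q.valuation L) d m (algebraMap F L a) (algebraMap F L b) :=
    h.toIsTwoSlope.map_algebraMap
  have hγ0 : γ ≠ 0 := root_ne_zero hq.pos hq.lt hq.ne_zero hγ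
  obtain ⟨c, hc⟩ := h.exists_pow_eq
  have hb0 : P.valuation F b ≠ 0 := (zero_lt_one.trans h.one_lt).ne'
  have hlog : WithZero.log (q.valuation L γ) = WithZero.log (P.valuation F (a / b)) := by
    have hpow := map_small_root_pow hq.lt hq.one_lt hγ hsmall
    rw [valuation_algebraMap P, valuation_algebraMap P, hram, ← mul_pow,
      pow_left_inj₀ zero_le zero_le h.pos.ne'] at hpow
    rw [map_div₀, ← hpow, mul_div_cancel_right₀ _ hb0]
  refine ⟨⟨h.pos, h.lt, hγ0, hq.one_lt, hsmall.trans hq.one_lt, hq.map_natCast_sub⟩,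
    ⟨algebraMap F L c, ?_⟩, ?_⟩
  · rw [← map_pow, ← map_pow, valuation_algebraMap P, valuation_algebraMap P, map_pow, hc]
  · have hlogb : WithZero.log (q.valuation L (algebraMap F L b)) =
        m * WithZero.log (P.valuation F b) := by
      rw [valuation_algebraMap P, hram, WithZero.log_pow, nsmul_eq_mul]
    rw [map_div₀, WithZero.log_div ((q.valuation L).ne_zero_iff.2 hγ0)
      (zero_lt_one.trans hq.one_lt).ne', hlog, hlogb, sub_eq_add_neg, ← mul_neg]
    exact h.isCoprime.add_mul_left_right _

variable {L : Type*} [Field L] [NumberField L] [Algebra F L] {α : L}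

lemma exists_ramified_root_of_splits (h : IsRamifiedTrinomial P d m a b)
    (hsplit : ((trinomialMap d m b - C a).map (algebraMap F M)).Splits)
    (hα : F⟮α⟯ = ⊤) (hmin : minpoly F α = trinomialMap d m b - C a) :
    ∃ q : HeightOneSpectrum (𝓞 L), q.asIdeal.LiesOver P.asIdeal ∧
      q.asIdeal.ramificationIdx (𝓞 F) = m ∧
      IsRamifiedTrinomial q d m α (algebraMap F L b) := by
  obtain ⟨Q, hQP⟩ := exists_liesOver M P
  obtain ⟨γ, hγ, hsmall⟩ := (h.toIsTwoSlope.map_algebraMap (Q := Q)).exists_small_root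
    (map_trinomialMap_sub_C (algebraMap F M) a b ▸ hsplit)
  have : FiniteDimensional F L := Module.Finite.of_restrictScalars_finite ℚ F L
  obtain ⟨φ, rfl⟩ : ∃ φ : L →ₐ[F] M, φ α = γ := by
    refine exists_algHom_of_adjoin_splits_of_aeval (S := {α}) ?_ hα ?_
    · simpa [hmin, Algebra.IsIntegral.isIntegral] using hsplit
    · rw [hmin, aeval_trinomialMap_sub_C_eq_zero_iff, hγ]
  let _ : Algebra L M := φ.toAlgebra
  have : IsScalarTower F L M := .of_algebraMap_eq fun x ↦ (φ.commutes x).symm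
  let q := Q.under (𝓞 L)
  have : Q.asIdeal.LiesOver q.asIdeal := ⟨rfl⟩
  have hqP : q.asIdeal.LiesOver P.asIdeal := .tower_bot Q.asIdeal _ _
  have hram : q.asIdeal.ramificationIdx (𝓞 F) = m :=
    (ncard_orbit_inertia_eq_ramificationIdx q hα).symm.trans
      (h.orbit_small_root hsplit hγ hsmall).2
  have hαsmall : q.valuation L α < 1 := by
    rwa [← pow_lt_one_iff_of_nonneg zero_le (ramificationIdx_ne_zero Q (F := L)),
      ← valuation_algebraMap]
  refine ⟨q, hqP, hram, h.of_small_root hram ?_ hαsmall⟩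
  exact aeval_trinomialMap_sub_C_eq_zero_iff.1 (hmin ▸ minpoly.aeval F α)

lemma exists_ramified_root (h : IsRamifiedTrinomial P d m a b)
    (hα : F⟮α⟯ = ⊤) (hmin : minpoly F α = trinomialMap d m b - C a) :
    ∃ q : HeightOneSpectrum (𝓞 L), q.asIdeal.LiesOver P.asIdeal ∧
      q.asIdeal.ramificationIdx (𝓞 F) = m ∧
      IsRamifiedTrinomial q d m α (algebraMap F L b) := by
  let M := (trinomialMap d m b - C a).SplittingField
  have : NumberField M := .of_module_finite F M
  have : IsGalois F M := { }
  exact h.exists_ramified_root_of_splits (SplittingField.splits _) hα hmin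

end IsRamifiedTrinomial

end RamifiedTrinomial

section Iterate

variable {K : Type*} [Field K]

lemma polyIterate_succ (f : K[X]) (n : ℕ) :
    polyIterate f (n + 1) = (polyIterate f n).comp f := by
  induction n with
  | zero => simp [polyIterate]
  | succ n ih =>
    have h (k : ℕ) : polyIterate f (k + 1) = f.comp (polyIterate f k) :=
      Function.iterate_succ_apply' _ _ _
    rw [h (n + 1), ih, ← comp_assoc, ← h n, ih]

lemma natDegree_polyIterate (f : K[X]) (n : ℕ) :
    (polyIterate f n).natDegree = f.natDegree ^ n := by
  rw [polyIterate, natDegree_iterate_comp, natDegree_X, mul_one]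

lemma isUnit_of_isUnit_comp {p f : K[X]} (hf : f.natDegree ≠ 0) (hp : IsUnit (p.comp f)) :
    IsUnit p := by
  have hdeg := natDegree_eq_zero_of_isUnit hp
  rw [natDegree_comp, mul_eq_zero, or_iff_left hf] at hdeg
  obtain ⟨c, rfl⟩ := natDegree_eq_zero.1 hdeg
  rwa [C_comp] at hp

lemma irreducible_of_comp {p f : K[X]} (hf : f.natDegree ≠ 0) (h : Irreducible (p.comp f)) :
    Irreducible p where
  not_isUnit hp := h.not_isUnit (hp.map (compRingHom f))
  isUnit_or_isUnit := by
    rintro q r rfl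
    rw [mul_comp] at h
    exact (h.isUnit_or_isUnit rfl).imp (isUnit_of_isUnit_comp hf) (isUnit_of_isUnit_comp hf)

lemma irreducible_polyIterate_of_succ {f : K[X]} (hf : f.natDegree ≠ 0) {n : ℕ} {x₀ : K}
    (h : Irreducible (polyIterate f (n + 1) - C x₀)) : Irreducible (polyIterate f n - C x₀) :=
  irreducible_of_comp hf (by rwa [sub_comp, C_comp, ← polyIterate_succ])

variable {Ω : Type*} [Field Ω] [Algebra K Ω]

lemma finrank_adjoin_iteratedFibre {f : K[X]} {n : ℕ} {x₀ : K} {α : Ω}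
    (hirr : Irreducible (polyIterate f n - C x₀))
    (hα : α ∈ iteratedFibre f n (algebraMap K Ω x₀)) :
    Module.finrank K K⟮α⟯ = f.natDegree ^ n := by
  have hroot : aeval α (polyIterate f n - C x₀) = 0 := by
    rw [map_sub, aeval_C, sub_eq_zero]
    exact hα
  have hint : IsIntegral K α := isAlgebraic_iff_isIntegral.1 ⟨_, hirr.ne_zero, hroot⟩
  rw [adjoin.finrank hint, ← minpoly.eq_of_irreducible hirr hroot,
    natDegree_mul_C (by simpa using hirr.ne_zero), natDegree_sub_C, natDegree_polyIterate]

lemma adjoin_gen_eq_top {α : Ω} (hα : IsIntegral K α) : K⟮AdjoinSimple.gen K α⟯ = ⊤ := by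
  have := adjoin.finiteDimensional hα
  rw [Field.primitive_element_iff_minpoly_natDegree_eq, minpoly_gen, adjoin.finrank hα]

end Iterate

section IteratedFibre

variable {K : Type*} [Field K] {𝔭 : HeightOneSpectrum (𝓞 K)} {d m : ℕ} {b x₀ : K}

namespace IsRamifiedTrinomial

lemma of_ramificationIdx_eq_one {F L : Type*} [Field F] [NumberField F] [Field L] [NumberField L]
    [Algebra F L] {P : HeightOneSpectrum (𝓞 F)} {Q : HeightOneSpectrum (𝓞 L)}
    [Q.asIdeal.LiesOver P.asIdeal] {a b : F} (h : IsRamifiedTrinomial P d m a b)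
    (hram : Q.asIdeal.ramificationIdx (𝓞 F) = 1) :
    IsRamifiedTrinomial Q d m (algebraMap F L a) (algebraMap F L b) := by
  have hval (x : F) : Q.valuation L (algebraMap F L x) = P.valuation F x := by
    rw [valuation_algebraMap P, hram, pow_one]
  obtain ⟨c, hc⟩ := h.exists_pow_eq
  refine ⟨h.toIsTwoSlope.map_algebraMap, ⟨algebraMap F L c, ?_⟩, ?_⟩
  · rw [hval, hval, hc]
  · rw [← map_div₀, hval]
    exact h.isCoprime

lemma exists_ramified_root_of_tower {F L : Type*} [Field F] [NumberField F] [Field L]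
    [NumberField L] [Algebra K F] [Algebra K L] [Algebra F L] [IsScalarTower K F L]
    {P : HeightOneSpectrum (𝓞 F)} [P.asIdeal.LiesOver 𝔭.asIdeal] {a : F} {α : L}
    (h : IsRamifiedTrinomial P d m a (algebraMap K F b)) (hα : K⟮α⟯ = ⊤)
    (hroot : α ^ d - algebraMap K L b * α ^ m = algebraMap F L a)
    (hdeg : Module.finrank F L = d) :
    ∃ 𝔓 : HeightOneSpectrum (𝓞 L), 𝔓.asIdeal.LiesOver 𝔭.asIdeal ∧
      𝔓.asIdeal.ramificationIdx (𝓞 K) = P.asIdeal.ramificationIdx (𝓞 K) * m ∧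
      IsRamifiedTrinomial 𝔓 d m α (algebraMap K L b) := by
  have : FiniteDimensional F L := Module.Finite.of_restrictScalars_finite ℚ F L
  have hα' : F⟮α⟯ = ⊤ := adjoin_eq_top_of_adjoin_eq_top K hα
  rw [IsScalarTower.algebraMap_apply K F L] at hroot
  have hmin : minpoly F α = trinomialMap d m (algebraMap K F b) - C a :=
    minpoly_eq_trinomialMap_sub_C h.lt hroot
      (((Field.primitive_element_iff_minpoly_natDegree_eq F α).1 hα').trans hdeg)
  obtain ⟨𝔓, hP, hram, h𝔓⟩ := h.exists_ramified_root hα' hmin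
  refine ⟨𝔓, .trans 𝔓.asIdeal P.asIdeal 𝔭.asIdeal, ?_, IsScalarTower.algebraMap_apply K F L b ▸ h𝔓⟩
  rw [Ideal.ramificationIdx_tower (R := 𝓞 K) P.asIdeal 𝔓.asIdeal, hram]

variable [NumberField K] {Ω : Type*} [Field Ω] [Algebra K Ω] [Algebra.IsAlgebraic K Ω]

lemma exists_ramified_iteratedFibre (h : IsRamifiedTrinomial 𝔭 d m x₀ b) (n : ℕ)
    (hirr : Irreducible (polyIterate (trinomialMap d m b) n - C x₀)) (α : Ω)
    (hα : α ∈ iteratedFibre (trinomialMap d m b) n (algebraMap K Ω x₀)) :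
    ∃ 𝔓 : HeightOneSpectrum (𝓞 K⟮α⟯), 𝔓.asIdeal.LiesOver 𝔭.asIdeal ∧
      𝔓.asIdeal.ramificationIdx (𝓞 K) = m ^ n ∧
      IsRamifiedTrinomial 𝔓 d m (AdjoinSimple.gen K α) (algebraMap K K⟮α⟯ b) := by
  have hfin := finrank_adjoin_iteratedFibre hirr hα
  rw [natDegree_trinomialMap h.lt] at hfin
  induction n generalizing α with
  | zero =>
    have hsurj : Function.Surjective (algebraMap K K⟮α⟯) := by
      rw [pow_zero] at hfin
      exact Algebra.surjective_algebraMap_iff.2 (Subalgebra.bot_eq_top_of_finrank_eq_one hfin).symm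
    have hgen : AdjoinSimple.gen K α = algebraMap K K⟮α⟯ x₀ :=
      Subtype.ext (by simpa [iteratedFibre, polyIterate] using hα)
    obtain ⟨𝔓, h𝔓⟩ := exists_liesOver K⟮α⟯ 𝔭
    have hram := ramificationIdx_eq_one_of_surjective hsurj 𝔓
    exact ⟨𝔓, h𝔓, hram, hgen ▸ h.of_ramificationIdx_eq_one hram⟩
  | succ n ih =>
    set f := trinomialMap d m b
    rw [iteratedFibre, Set.mem_ofPred_eq, polyIterate_succ, aeval_comp] at hα
    have hirr' := irreducible_polyIterate_of_succ (f := f)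
      ((natDegree_trinomialMap h.lt b).trans_ne (h.pos.trans h.lt).ne') hirr
    have hfin' := finrank_adjoin_iteratedFibre hirr' hα
    rw [natDegree_trinomialMap h.lt] at hfin'
    obtain ⟨P, hP, hram, hP'⟩ := ih hirr' (aeval α f) hα hfin'
    have haeval : aeval α f ∈ K⟮α⟯ :=
      algebra_adjoin_le_adjoin K {α} (aeval_mem_adjoin_singleton K α)
    let _ : Algebra K⟮aeval α f⟯ K⟮α⟯ := (inclusion (adjoin_simple_le_iff.2 haeval)).toAlgebra
    have : IsScalarTower K K⟮aeval α f⟯ K⟮α⟯ := .of_algebraMap_eq fun x ↦ rfl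
    have hdeg : Module.finrank K⟮aeval α f⟯ K⟮α⟯ = d := by
      have hmul := Module.finrank_mul_finrank K K⟮aeval α f⟯ K⟮α⟯
      rw [hfin', hfin, pow_succ] at hmul
      exact Nat.eq_of_mul_eq_mul_left (pow_pos (h.pos.trans h.lt) n) hmul
    have hroot : AdjoinSimple.gen K α ^ d - algebraMap K K⟮α⟯ b * AdjoinSimple.gen K α ^ m =
        algebraMap K⟮aeval α f⟯ K⟮α⟯ (AdjoinSimple.gen K (aeval α f)) := by
      apply Subtype.ext
      change α ^ d - algebraMap K Ω b * α ^ m = aeval α f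
      simp [f, trinomialMap]
    have hgen := adjoin_gen_eq_top (Algebra.IsIntegral.isIntegral (R := K) α)
    obtain ⟨𝔓, h𝔓⟩ := hP'.exists_ramified_root_of_tower (𝔭 := 𝔭) hgen hroot hdeg
    exact ⟨𝔓, by rwa [hram, ← pow_succ] at h𝔓⟩

end IsRamifiedTrinomial

end IteratedFibre

section PrimeOrd

variable {K : Type*} [Field K] [NumberField K] {𝔭 : HeightOneSpectrum (𝓞 K)} {d m : ℕ} {a b : K}

lemma exists_valuation_pow_eq_of_dvd_primeOrd (hb : b ≠ 0) {k : ℕ} (hdvd : (k : ℤ) ∣ primeOrd 𝔭 b) :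
    ∃ c, 𝔭.valuation K c ^ k = 𝔭.valuation K b := by
  obtain ⟨j, hj⟩ := hdvd
  obtain ⟨c, hc⟩ := 𝔭.valuation_surjective K (WithZero.exp (-j))
  refine ⟨c, ?_⟩
  rw [hc, ← WithZero.exp_nsmul, ← WithZero.exp_log ((𝔭.valuation K).ne_zero_iff.2 hb)]
  congr 1
  rw [primeOrd] at hj
  rw [nsmul_eq_mul]
  linarith

lemma isRamifiedTrinomial_of_primeOrd (hm : 0 < m) (hmd : m < d) (ha : a ≠ 0)
    (hdm : (d : 𝓞 K) - (m : 𝓞 K) ∉ 𝔭.asIdeal) (hb : primeOrd 𝔭 b < min (primeOrd 𝔭 a) 0)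
    (hdvd : (d : ℤ) - (m : ℤ) ∣ primeOrd 𝔭 b)
    (hgcd : Int.gcd (m : ℤ) (primeOrd 𝔭 (a / b)) = 1) : IsRamifiedTrinomial 𝔭 d m a b := by
  obtain ⟨hba, hb0⟩ := lt_min_iff.1 hb
  have hb' : b ≠ 0 := by
    rintro rfl
    simp [primeOrd] at hb0
  rw [← Nat.cast_sub hmd.le] at hdvd
  have hva := (𝔭.valuation K).ne_zero_iff.2 ha
  have hvb := (𝔭.valuation K).ne_zero_iff.2 hb'
  refine ⟨⟨hm, hmd, ha, ?_, ?_, ?_⟩, exists_valuation_pow_eq_of_dvd_primeOrd hb' hdvd, ?_⟩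
  · rw [← WithZero.log_lt_log one_ne_zero hvb, WithZero.log_one]
    exact neg_lt_zero.1 hb0
  · exact (WithZero.log_lt_log hva hvb).1 (neg_lt_neg_iff.1 hba)
  · simpa using 𝔭.valuation_eq_one_iff_notMem (K := K).2 hdm
  · exact (IsCoprime.neg_right_iff _ _).1 (Int.isCoprime_iff_gcd_eq_one.2 hgcd)

lemma IsRamifiedTrinomial.exists_coprime_extendedOrd {F : Type*} [Field F] [Algebra F K]
    (h : IsRamifiedTrinomial 𝔭 d m a b) (he : 𝔭.asIdeal.ramificationIdx (𝓞 F) ≠ 0) :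
    ∃ N : ℕ, 0 < N ∧ N.Coprime m ∧
      (𝔭.asIdeal.ramificationIdx (𝓞 F) : ℚ) * extendedOrd F 𝔭 (a / b) = N := by
  have hpos : 0 < primeOrd 𝔭 (a / b) := by
    have hvb := (zero_lt_one.trans h.one_lt).ne'
    have hva := (𝔭.valuation K).ne_zero_iff.2 h.ne_zero
    rw [primeOrd, map_div₀, WithZero.log_div hva hvb, neg_pos, sub_neg, WithZero.log_lt_log hva hvb]
    exact h.map_lt
  have hcop : IsCoprime (primeOrd 𝔭 (a / b)) (m : ℤ) := h.isCoprime.symm.neg_left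
  lift primeOrd 𝔭 (a / b) to ℕ using hpos.le with N hN
  refine ⟨N, by exact_mod_cast hpos, Nat.isCoprime_iff_coprime.1 hcop, ?_⟩
  rw [extendedOrd, ← hN, Int.cast_natCast, mul_div_cancel₀ _ (Nat.cast_ne_zero.2 he)]

end PrimeOrd

section FibreField

variable {K Ω : Type*} [Field K] [Field Ω] [Algebra K Ω] {d m : ℕ} {b : K} {α : Ω}

lemma mem_iteratedFibre_one_trinomialMap {γ : Ω} :
    γ ∈ iteratedFibre (trinomialMap d m b) 1 α ↔ γ ^ d - algebraMap K Ω b * γ ^ m = α := by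
  simp [iteratedFibre, polyIterate, trinomialMap]

lemma isSplittingField_fibreField (hmd : m < d)
    (hsplit : (trinomialMap d m (algebraMap K Ω b) - C α).Splits) :
    (trinomialMap d m (algebraMap K K⟮α⟯ b) - C (AdjoinSimple.gen K α)).IsSplittingField K⟮α⟯
      (fibreField (trinomialMap d m b) α) := by
  set g := trinomialMap d m (algebraMap K K⟮α⟯ b) - C (AdjoinSimple.gen K α)
  have hfibre : iteratedFibre (trinomialMap d m b) 1 α = g.rootSet Ω := by
    ext γ
    rw [mem_iteratedFibre_one_trinomialMap,
      mem_rootSet_of_ne (monic_trinomialMap_sub_C hmd _ _).ne_zero,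
      aeval_trinomialMap_sub_C_eq_zero_iff, ← IsScalarTower.algebraMap_apply,
      AdjoinSimple.algebraMap_gen]
  rw [fibreField, hfibre]
  refine adjoin_rootSet_isSplittingField ?_
  rwa [map_trinomialMap_sub_C, ← IsScalarTower.algebraMap_apply, AdjoinSimple.algebraMap_gen]

end FibreField

theorem lemma2p3_general {K Ω : Type*} [Field K] [NumberField K] [Field Ω] [Algebra K Ω]
    [Algebra.IsAlgebraic K Ω]
    (d m : ℕ) (hm : 0 < m) (hmd : m < d) (b x₀ : K) (hx₀ : x₀ ≠ 0)
    (𝔭 : HeightOneSpectrum (𝓞 K))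
    (hdm : (d : 𝓞 K) - (m : 𝓞 K) ∉ 𝔭.asIdeal)
    (hb : primeOrd 𝔭 b < min (primeOrd 𝔭 x₀) 0)
    (hdvd : (d : ℤ) - (m : ℤ) ∣ primeOrd 𝔭 b)
    (hgcd : Int.gcd (m : ℤ) (primeOrd 𝔭 (x₀ / b)) = 1)
    (n : ℕ)
    (hirr : Irreducible (polyIterate (trinomialMap d m b) n - C x₀))
    (α : Ω) (hα : α ∈ iteratedFibre (trinomialMap d m b) n (algebraMap K Ω x₀))
    (hsplit : (trinomialMap d m (algebraMap K Ω b) - C α).Splits) :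
    ∃ (𝔓 : HeightOneSpectrum (𝓞 K⟮α⟯))
      (𝔔 : HeightOneSpectrum (𝓞 (fibreField (trinomialMap d m b) α))),
      𝔓.asIdeal.LiesOver 𝔭.asIdeal ∧
      𝔓.asIdeal.ramificationIdx (𝓞 K) = m ^ n ∧
      (∃ N : ℕ, 0 < N ∧ N.Coprime m ∧
        (m : ℚ) ^ n *
          extendedOrd K 𝔓 (AdjoinSimple.gen K α / algebraMap K K⟮α⟯ b) = N) ∧
      𝔔.asIdeal.LiesOver 𝔓.asIdeal ∧
      ∃ S T : Set (fibreField (trinomialMap d m b) α),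
        S ∪ T = Subtype.val ⁻¹' iteratedFibre (trinomialMap d m b) 1 α ∧ Disjoint S T ∧
        S.ncard = m ∧ T.ncard = d - m ∧
        (∀ σ ∈ 𝔔.asIdeal.inertia Gal(fibreField (trinomialMap d m b) α/K⟮α⟯), ∀ γ ∈ S, σ γ ∈ S) ∧
        (∀ γ ∈ S, ∀ δ ∈ S,
          ∃ σ ∈ 𝔔.asIdeal.inertia Gal(fibreField (trinomialMap d m b) α/K⟮α⟯), σ γ = δ) ∧
        ∀ σ ∈ 𝔔.asIdeal.inertia Gal(fibreField (trinomialMap d m b) α/K⟮α⟯), ∀ γ ∈ T, σ γ = γ := by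
  have h𝔭 := isRamifiedTrinomial_of_primeOrd hm hmd hx₀ hdm hb hdvd hgcd
  obtain ⟨𝔓, hover, hram, h𝔓⟩ := h𝔭.exists_ramified_iteratedFibre n hirr α hα
  set M := fibreField (trinomialMap d m b) α
  let g := trinomialMap d m (algebraMap K K⟮α⟯ b) - C (AdjoinSimple.gen K α)
  have hM : g.IsSplittingField K⟮α⟯ M := isSplittingField_fibreField hmd hsplit
  have : FiniteDimensional K⟮α⟯ M := IsSplittingField.finiteDimensional M g
  have : NumberField M := .of_module_finite K⟮α⟯ M
  have : Normal K⟮α⟯ M := .of_isSplittingField g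
  have : IsGalois K⟮α⟯ M := { }
  obtain ⟨𝔔, hQ⟩ := exists_liesOver M 𝔓
  obtain ⟨S, T, hST, hinertia⟩ := h𝔓.exists_inertia_orbit_union_fixed (Q := 𝔔) hM.splits
  refine ⟨𝔓, 𝔔, hover, hram, ?_, hQ, S, T, ?_, hinertia⟩
  · have hord := h𝔓.exists_coprime_extendedOrd (ramificationIdx_ne_zero 𝔓 (F := K))
    rwa [hram, Nat.cast_pow] at hord
  · rw [hST]
    ext γ
    rw [Set.mem_preimage, mem_iteratedFibre_one_trinomialMap, Set.mem_ofPred_eq, Subtype.ext_iff]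
    rfl

theorem lemma2p3 {K Ω : Type*} [Field K] [NumberField K] [Field Ω] [Algebra K Ω]
    [IsAlgClosed Ω] [Algebra.IsAlgebraic K Ω]
    (d m : ℕ) (hm : 2 ≤ m) (hmd : m < d) (b x₀ : K) (hx₀ : x₀ ≠ 0)
    (𝔭 : HeightOneSpectrum (𝓞 K))
    (hdm : (d : 𝓞 K) - (m : 𝓞 K) ∉ 𝔭.asIdeal)
    (hb : primeOrd 𝔭 b < min (primeOrd 𝔭 x₀) 0)
    (hdvd : (d : ℤ) - (m : ℤ) ∣ primeOrd 𝔭 b)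
    (hgcd : Int.gcd (m : ℤ) (primeOrd 𝔭 (x₀ / b)) = 1)
    (n : ℕ)
    (hirr : Irreducible (polyIterate (trinomialMap d m b) n - C x₀))
    (α : Ω) (hα : α ∈ iteratedFibre (trinomialMap d m b) n (algebraMap K Ω x₀)) :
    ∃ (𝔓 : HeightOneSpectrum (𝓞 K⟮α⟯))
      (𝔔 : HeightOneSpectrum (𝓞 (fibreField (trinomialMap d m b) α))),
      𝔓.asIdeal.LiesOver 𝔭.asIdeal ∧
      𝔓.asIdeal.ramificationIdx (𝓞 K) = m ^ n ∧
      (∃ N : ℕ, 0 < N ∧ N.Coprime m ∧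
        (m : ℚ) ^ n *
          extendedOrd K 𝔓 (AdjoinSimple.gen K α / algebraMap K K⟮α⟯ b) = N) ∧
      𝔔.asIdeal.LiesOver 𝔓.asIdeal ∧
      -- the `d` roots of `f(x) - α` split into a set `S` of `m` roots, permuted transitively by
      -- the inertia group, and the `d - m` remaining ones, each of which it fixes
      ∃ S T : Set (fibreField (trinomialMap d m b) α),
        S ∪ T = Subtype.val ⁻¹' iteratedFibre (trinomialMap d m b) 1 α ∧ Disjoint S T ∧
        S.ncard = m ∧ T.ncard = d - m ∧
        (∀ σ ∈ 𝔔.asIdeal.inertia Gal(fibreField (trinomialMap d m b) α/K⟮α⟯), ∀ γ ∈ S, σ γ ∈ S) ∧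
        (∀ γ ∈ S, ∀ δ ∈ S,
          ∃ σ ∈ 𝔔.asIdeal.inertia Gal(fibreField (trinomialMap d m b) α/K⟮α⟯), σ γ = δ) ∧
        (∀ σ ∈ 𝔔.asIdeal.inertia Gal(fibreField (trinomialMap d m b) α/K⟮α⟯), ∀ γ ∈ T, σ γ = γ) :=
  lemma2p3_general d m (by lia) hmd b x₀ hx₀ 𝔭 hdm hb hdvd hgcd n hirr α hα (IsAlgClosed.splits _)
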